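/- Let $T,\rho,c,m>0$, $x_0\in\mathbb{R}$, and let $M>0$ satisfy $M\le m\int_0^T e^{-ct}\,dt$. Let $w$ be a standard real Brownian motion on $[0,T]$ with respect to a filtration $(\mathcal F_t)_{t\in[0,T]}$ on a probability space $(\Omega,\mathcal F,P)$, and let $\sigma:\mathbb{R}^2\to\mathbb{R}$ be Borel measurable. An admissible control is a measurable adapted process $u=(u_t)_{t\in[0,T]}$ with values in $[0,m]$. A goodwill process associated with $u$ is a solution $x$ on $[0,T]$ of $$dx_t=(-\rho x_t+u_t)\,dt+\sigma(x_t,u_t)\,dw_t,\qquad x_0 \text{ given},$$ that is, a measurable adapted process with almost surely continuous paths and $E\int_0^T \big(x_t^2+\sigma(x_t,u_t)^2\big)\,dt<\infty$ that satisfies the integrated equation almost surely for each $t\in[0,T]$, the stochastic integral being the Itô integral. (If $\sigma$ is Lipschitz, the integrability of $x$ and $\sigma(x,u)$ is automatic for solutions.) Consider the problem of maximizing $E[x_T]$ over all admissible controls $u$ with $$E\int_0^T e^{-ct}u_t\,dt\le M$$ and all associated goodwill processes $x$. Put $$t_*=-\frac1c\log\Big(e^{-cT}+\frac{cM}{m}\Big),\qquad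 u_*(t)=\begin{cases}0,& t\le t_*,\\ m,& t>t_*.\end{cases}$$ Then: 1. $t_*\in[0,T)$, and $t_*$ is the unique real number $t$ with $e^{-ct}-e^{-cT}=cM/m$. 2. $u_*$ is admissible and uses exactly the whole budget: $E\int_0^T e^{-ct}u_*(t)\,dt=M$. 3. $E[x_T]$ is well defined and finite for every admissible control and every associated goodwill process $x$. 4. $u_*$ is optimal: if $x^*$ is a goodwill process associated with $u_*$, then $E[x^*_T]$ is the maximum of the constrained problem. Moreover, every admissible control $u$ within the budget that has an associated goodwill process $x$ with $E[x_T]=E[x^*_T]$ satisfies $u_t(\omega)=u_*(t)$ for $dt\otimes P$-almost every $(t,\omega)\in[0,T]\times\Omega$. -/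

import Mathlib

open MeasureTheory ProbabilityTheory Set Filter Topology

noncomputable section

/-- `w` is a standard real Brownian motion on `[0, T]` with respect to the filtration `ℱ`.
Only the values of `w` and `ℱ` at times in `[0, T]` matter. -/
structure IsBrownianMotionOn {Ω : Type*} {mΩ : MeasurableSpace Ω} (P : Measure Ω)
    (ℱ : Filtration ℝ mΩ) (T : ℝ) (w : ℝ → Ω → ℝ) : Prop where
  start : ∀ᵐ ω ∂P, w 0 ω = 0
  adapted : ∀ t ∈ Icc 0 T, Measurable[ℱ t] (w t)
  indep : ∀ s t : ℝ, 0 ≤ s → s ≤ t → t ≤ T →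
    Indep (MeasurableSpace.comap (fun ω => w t ω - w s ω) (borel ℝ)) (ℱ s) P
  law : ∀ s t : ℝ, 0 ≤ s → s ≤ t → t ≤ T →
    HasLaw (fun ω => w t ω - w s ω) (gaussianReal 0 (t - s).toNNReal) P
  cont : ∀ᵐ ω ∂P, ContinuousOn (fun t => w t ω) (Icc 0 T)

/-- Elementary (simple, bounded, adapted) integrands `∑ i < n, ξ i · 1_(τ i, τ (i+1)]` on
`[0, T]`, where `ξ i` is bounded and `ℱ (τ i)`-measurable. -/
structure ElementaryProcess {Ω : Type*} {mΩ : MeasurableSpace Ω}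
    (ℱ : Filtration ℝ mΩ) (T : ℝ) where
  n : ℕ
  time : ℕ → ℝ
  coeff : ℕ → Ω → ℝ
  time_mono : Monotone time
  time_mem : ∀ i, time i ∈ Icc 0 T
  coeff_measurable : ∀ i, Measurable[ℱ (time i)] (coeff i)
  coeff_bounded : ∀ i, ∃ C : ℝ, ∀ ω, |coeff i ω| ≤ C

/-- The value of an elementary process at time `t`. -/
def ElementaryProcess.eval {Ω : Type*} {mΩ : MeasurableSpace Ω} {ℱ : Filtration ℝ mΩ} {T : ℝ}
    (E : ElementaryProcess ℱ T) (t : ℝ) (ω : Ω) : ℝ :=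
  ∑ i ∈ Finset.range E.n, (Ioc (E.time i) (E.time (i + 1))).indicator (fun _ => E.coeff i ω) t

/-- The stochastic integral over `[0, t]` of an elementary process against `w`. -/
def ElementaryProcess.integral {Ω : Type*} {mΩ : MeasurableSpace Ω} {ℱ : Filtration ℝ mΩ} {T : ℝ}
    (E : ElementaryProcess ℱ T) (w : ℝ → Ω → ℝ) (t : ℝ) (ω : Ω) : ℝ :=
  ∑ i ∈ Finset.range E.n,
    E.coeff i ω * (w (min (E.time (i + 1)) t) ω - w (min (E.time i) t) ω)

/-- `I t = ∫₀ᵗ H dw` for `t ∈ [0, T]`, in the sense of Itô: `H` is square integrable on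
`[0, T] × Ω`, it is an `L²([0, T] × Ω)`-limit of elementary processes, and for each `t` the
variable `I t` is the `L²(Ω)`-limit of their elementary stochastic integrals. -/
structure IsItoIntegral {Ω : Type*} {mΩ : MeasurableSpace Ω} (P : Measure Ω)
    (ℱ : Filtration ℝ mΩ) (T : ℝ) (w : ℝ → Ω → ℝ) (H I : ℝ → Ω → ℝ) : Prop where
  integrand_memLp : MemLp (fun p : ℝ × Ω => H p.1 p.2) 2 ((volume.restrict (Icc 0 T)).prod P)
  memLp : ∀ t ∈ Icc 0 T, MemLp (I t) 2 P
  approx : ∃ E : ℕ → ElementaryProcess ℱ T,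
    Tendsto (fun k => eLpNorm (fun p : ℝ × Ω => (E k).eval p.1 p.2 - H p.1 p.2) 2
      ((volume.restrict (Icc 0 T)).prod P)) atTop (𝓝 0) ∧
    ∀ t ∈ Icc 0 T,
      Tendsto (fun k => eLpNorm (fun ω => (E k).integral w t ω - I t ω) 2 P) atTop (𝓝 0)

/-- Admissible controls: measurable, adapted processes on `[0, T]` with values in `[0, m]`. -/
structure IsControl {Ω : Type*} {mΩ : MeasurableSpace Ω}
    (ℱ : Filtration ℝ mΩ) (T m : ℝ) (u : ℝ → Ω → ℝ) : Prop where
  measurable : Measurable (fun p : ℝ × Ω => u p.1 p.2)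
  adapted : ∀ t ∈ Icc 0 T, Measurable[ℱ t] (u t)
  mem_Icc : ∀ t ∈ Icc 0 T, ∀ ω, u t ω ∈ Icc 0 m

/-- `x` is a (square integrable) solution on `[0, T]` of
`dx = (-ρ x + u) dt + σ(x, u) dw`, `x 0 = x₀`. -/
structure IsGoodwill {Ω : Type*} {mΩ : MeasurableSpace Ω} (P : Measure Ω)
    (ℱ : Filtration ℝ mΩ) (T : ℝ) (w : ℝ → Ω → ℝ) (ρ : ℝ) (σ : ℝ → ℝ → ℝ) (x₀ : ℝ)
    (u x : ℝ → Ω → ℝ) : Prop where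
  measurable : Measurable (fun p : ℝ × Ω => x p.1 p.2)
  adapted : ∀ t ∈ Icc 0 T, Measurable[ℱ t] (x t)
  cont : ∀ᵐ ω ∂P, ContinuousOn (fun t => x t ω) (Icc 0 T)
  memLp : MemLp (fun p : ℝ × Ω => x p.1 p.2) 2 ((volume.restrict (Icc 0 T)).prod P)
  equation : ∃ I : ℝ → Ω → ℝ,
    IsItoIntegral P ℱ T w (fun t ω => σ (x t ω) (u t ω)) I ∧
    ∀ t ∈ Icc 0 T, ∀ᵐ ω ∂P,
      x t ω = x₀ + (∫ r in (0 : ℝ)..t, (-ρ * x r ω + u r ω)) + I t ω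

/-- The expected discounted cost `E ∫₀ᵀ e^{-ct} u_t dt`. -/
def discountedCost {Ω : Type*} {mΩ : MeasurableSpace Ω} (P : Measure Ω) (c T : ℝ)
    (u : ℝ → Ω → ℝ) : ℝ :=
  ∫ ω, (∫ t in (0 : ℝ)..T, Real.exp (-c * t) * u t ω) ∂P

/-- Admissible controls that respect the budget `M`. -/
def IsFeasible {Ω : Type*} {mΩ : MeasurableSpace Ω} (P : Measure Ω)
    (ℱ : Filtration ℝ mΩ) (T m c M : ℝ) (u : ℝ → Ω → ℝ) : Prop :=
  IsControl ℱ T m u ∧ discountedCost P c T u ≤ M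

/-- The values `E[x_T]` of the constrained problem, over all feasible controls and
corresponding solutions. -/
def constrainedValues {Ω : Type*} {mΩ : MeasurableSpace Ω} (P : Measure Ω)
    (ℱ : Filtration ℝ mΩ) (T : ℝ) (w : ℝ → Ω → ℝ) (ρ : ℝ) (σ : ℝ → ℝ → ℝ) (x₀ m c M : ℝ) :
    Set ℝ :=
  {J | ∃ u x : ℝ → Ω → ℝ, IsFeasible P ℱ T m c M u ∧ IsGoodwill P ℱ T w ρ σ x₀ u x ∧
    J = ∫ ω, x T ω ∂P}

/-- The policy equal to `0` up to time `τ` and to `m` afterwards. -/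
def bangBang {Ω : Type*} (m τ : ℝ) : ℝ → Ω → ℝ :=
  fun t _ => if t ≤ τ then 0 else m

/-- The switching time `-(1/c) log (e^{-cT} + c M / m)`. -/
def switchingTime (c T m M : ℝ) : ℝ :=
  -(1 / c) * Real.log (Real.exp (-c * T) + c * M / m)

end

/-! An Itô integral has mean zero, so the mean of `x` obeys a linear integral equation that does not
involve `σ`. Variation of constants turns `e^{ρT} E[x_T]` into `x₀` plus the integral of `e^{ρt} u`
over `[0, T] × Ω` (`IsGoodwill.exp_mul_integral_eq`), and the stochastic problem becomes a linear
one with a single linear constraint.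

That problem is solved as in the Neyman–Pearson lemma. The ratio `e^{(ρ+c)t}` of gain to cost
increases with time, so the budget should be spent as late and as fast as possible. With the
multiplier `e^{(ρ+c)τ}`, the ratio at the switching time `τ`, the integrand `bangBangGap` is
nonnegative; its integral is at most the gain of the bang-bang policy over its competitor, since the
competitor costs at most `M`. If the gain is zero, the integrand vanishes almost everywhere, which
forces the two controls to agree. -/

/-- An increment of a Brownian motion is centred, also after multiplication by a variable
known at its starting time. -/
lemma IsBrownianMotionOn.integral_mul_increment {Ω : Type*} {mΩ : MeasurableSpace Ω}
    {P : Measure Ω} {ℱ : Filtration ℝ mΩ} {T : ℝ} {w : ℝ → Ω → ℝ}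
    (hw : IsBrownianMotionOn P ℱ T w) {s t : ℝ} (hs : 0 ≤ s) (hst : s ≤ t) (ht : t ≤ T)
    {ξ : Ω → ℝ} (hξ : Measurable[ℱ s] ξ) :
    ∫ ω, ξ ω * (w t ω - w s ω) ∂P = 0 := by
  have hind : IndepFun ξ (fun ω => w t ω - w s ω) P := by
    rw [IndepFun_iff_Indep]
    refine indep_of_indep_of_le_left (Indep.symm ?_) hξ.comap_le
    have := hw.indep s t hs hst ht
    rwa [← BorelSpace.measurable_eq (α := ℝ)] at this
  have hlaw := hw.law s t hs hst ht
  rw [hind.integral_fun_mul_eq_mul_integral (hξ.mono (ℱ.le s) le_rfl).aestronglyMeasurable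
    hlaw.aemeasurable.aestronglyMeasurable, hlaw.integral_eq, integral_id_gaussianReal, mul_zero]

lemma IsBrownianMotionOn.integrable_increment {Ω : Type*} {mΩ : MeasurableSpace Ω}
    {P : Measure Ω} {ℱ : Filtration ℝ mΩ} {T : ℝ} {w : ℝ → Ω → ℝ}
    (hw : IsBrownianMotionOn P ℱ T w) {s t : ℝ} (hs : 0 ≤ s) (hst : s ≤ t) (ht : t ≤ T) :
    Integrable (fun ω => w t ω - w s ω) P := by
  have hlaw := hw.law s t hs hst ht
  have h : Integrable id (P.map fun ω => w t ω - w s ω) := by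
    rw [hlaw.map_eq]
    exact (memLp_id_gaussianReal 1).integrable (by norm_num)
  exact (integrable_map_measure aestronglyMeasurable_id hlaw.aemeasurable).1 h

lemma ElementaryProcess.integral_summand {Ω : Type*} {mΩ : MeasurableSpace Ω}
    {P : Measure Ω} {ℱ : Filtration ℝ mΩ} {T : ℝ} {w : ℝ → Ω → ℝ}
    (hw : IsBrownianMotionOn P ℱ T w) (E : ElementaryProcess ℱ T) {t : ℝ} (ht : t ∈ Icc 0 T)
    (i : ℕ) :
    Integrable (fun ω => E.coeff i ω * (w (min (E.time (i + 1)) t) ω - w (min (E.time i) t) ω)) P ∧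
    ∫ ω, E.coeff i ω * (w (min (E.time (i + 1)) t) ω - w (min (E.time i) t) ω) ∂P = 0 := by
  have hmono : E.time i ≤ E.time (i + 1) := E.time_mono (Nat.le_succ i)
  -- If `t` precedes the `i`-th interval, both truncated times equal `t` and the summand is zero.
  rcases le_total t (E.time i) with h | h
  · simp [min_eq_right h, min_eq_right (h.trans hmono)]
  · rw [min_eq_left h]
    have h0 := (E.time_mem i).1
    have h1 : E.time i ≤ min (E.time (i + 1)) t := le_min hmono h
    have h2 : min (E.time (i + 1)) t ≤ T := (min_le_right _ _).trans ht.2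
    obtain ⟨C, hC⟩ := E.coeff_bounded i
    exact ⟨(hw.integrable_increment h0 h1 h2).bdd_mul
      ((E.coeff_measurable i).mono (ℱ.le _) le_rfl).aestronglyMeasurable (c := C)
      (Eventually.of_forall hC), hw.integral_mul_increment h0 h1 h2 (E.coeff_measurable i)⟩

/-- Itô integrals are centred. -/
lemma IsItoIntegral.integral_eq_zero {Ω : Type*} {mΩ : MeasurableSpace Ω}
    {P : Measure Ω} [IsProbabilityMeasure P] {ℱ : Filtration ℝ mΩ} {T : ℝ} {w : ℝ → Ω → ℝ}
    (hw : IsBrownianMotionOn P ℱ T w) {H I : ℝ → Ω → ℝ} (hI : IsItoIntegral P ℱ T w H I)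
    {t : ℝ} (ht : t ∈ Icc 0 T) : ∫ ω, I t ω ∂P = 0 := by
  obtain ⟨E, -, hE⟩ := hI.approx
  have hint (k : ℕ) : Integrable ((E k).integral w t) P :=
    integrable_finsetSum _ fun i _ => ((E k).integral_summand hw ht i).1
  have hzero (k : ℕ) : ∫ ω, (E k).integral w t ω ∂P = 0 := by
    unfold ElementaryProcess.integral
    rw [integral_finsetSum _ fun i _ => ((E k).integral_summand hw ht i).1]
    exact Finset.sum_eq_zero fun i _ => ((E k).integral_summand hw ht i).2
  have hm : AEStronglyMeasurable (I t) P := (hI.memLp t ht).1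
  -- On a probability space `L²` convergence implies `L¹` convergence, through which means pass to
  -- the limit.
  have h1 : Tendsto (fun k => eLpNorm ((E k).integral w t - I t) 1 P) atTop (𝓝 0) :=
    tendsto_of_tendsto_of_tendsto_of_le_of_le tendsto_const_nhds (hE t ht) (fun _ => zero_le)
      fun k => eLpNorm_le_eLpNorm_of_exponent_le one_le_two ((hint k).1.sub hm)
  have h2 := tendsto_integral_of_L1' (I t) hm (Eventually.of_forall hint) h1
  simp_rw [hzero] at h2
  exact (tendsto_nhds_unique h2 tendsto_const_nhds)

/-! ### The mean goodwill as a functional of the control -/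

/-- Variation of constants for the integrated form of `F' = -ρ F + v`, `F 0 = a`. -/
lemma exp_mul_eq_of_linear_integral_equation {T ρ a : ℝ} (hT : 0 ≤ T) {F v : ℝ → ℝ}
    (hint : IntervalIntegrable (fun r => -ρ * F r + v r) volume 0 T)
    (hF : ∀ t ∈ Icc 0 T, F t = a + ∫ r in (0 : ℝ)..t, (-ρ * F r + v r)) :
    Real.exp (ρ * T) * F T = a + ∫ r in (0 : ℝ)..T, Real.exp (ρ * r) * v r := by
  -- `F` is controlled only on `[0, T]`. Its extension `G` is absolutely continuous there, so
  -- integration by parts applies although `v` need not be continuous.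
  set G : ℝ → ℝ := fun t => (∫ r in (0 : ℝ)..t, (-ρ * F r + v r)) + a with hG
  have hGac : AbsolutelyContinuousOnInterval G 0 T :=
    (hint.absolutelyContinuousOnInterval_intervalIntegral (c := 0) (by simp)).fun_add
      (contDiffOn_const.absolutelyContinuousOnInterval)
  have hEac : AbsolutelyContinuousOnInterval (fun t => Real.exp (ρ * t)) 0 T :=
    ContDiffOn.absolutelyContinuousOnInterval (by fun_prop)
  have hparts := hEac.integral_deriv_mul_eq_sub hGac
  have hcongr : ∫ x in (0 : ℝ)..T, deriv (fun t => Real.exp (ρ * t)) x * G x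
      + Real.exp (ρ * x) * deriv G x = ∫ r in (0 : ℝ)..T, Real.exp (ρ * r) * v r := by
    apply intervalIntegral.integral_congr_ae
    filter_upwards [hint.ae_hasDerivAt_integral] with x hx hxT
    have hx' := uIoc_subset_uIcc hxT
    have h1 : HasDerivAt G (-ρ * F x + v x) x := (hx hx' 0 (by simp)).add_const a
    have h2 : HasDerivAt (fun t => Real.exp (ρ * t)) (Real.exp (ρ * x) * (ρ * 1)) x :=
      ((hasDerivAt_id x).const_mul ρ).exp
    rw [h1.deriv, h2.deriv]
    rw [uIcc_of_le hT] at hx'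
    have h3 : G x = F x := by rw [hF x hx', hG]; ring
    rw [h3]; ring
  have hGT : G T = F T := by rw [hF T ⟨hT, le_rfl⟩, hG]; ring
  have hG0 : G 0 = a := by simp [hG]
  rw [hcongr, hGT, hG0] at hparts
  simp at hparts
  linarith

lemma ae_fst_mem_Icc {Ω : Type*} {mΩ : MeasurableSpace Ω} (P : Measure Ω) [SFinite P] (T : ℝ) :
    ∀ᵐ p : ℝ × Ω ∂((volume.restrict (Icc 0 T)).prod P), p.1 ∈ Icc 0 T :=
  Measure.quasiMeasurePreserving_fst.ae (ae_restrict_mem measurableSet_Icc)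

lemma IsControl.integrable_mul {Ω : Type*} {mΩ : MeasurableSpace Ω} {P : Measure Ω}
    [IsProbabilityMeasure P] {ℱ : Filtration ℝ mΩ} {T m : ℝ} {u : ℝ → Ω → ℝ}
    (hu : IsControl ℱ T m u) {φ : ℝ → ℝ} (hφ : Continuous φ) :
    Integrable (fun p : ℝ × Ω => φ p.1 * u p.1 p.2) ((volume.restrict (Icc 0 T)).prod P) := by
  have h1 : Integrable φ (volume.restrict (Icc 0 T)) :=
    hφ.continuousOn.integrableOn_compact isCompact_Icc
  refine (h1.comp_fst P).mul_bdd (c := m) hu.measurable.aestronglyMeasurable ?_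
  filter_upwards [ae_fst_mem_Icc P T] with p hp
  have := hu.mem_Icc p.1 hp p.2
  rw [Real.norm_of_nonneg this.1]
  exact this.2

/-- Time integral of expectations as an integral over the product. -/
lemma intervalIntegral_integral_eq_prod {Ω : Type*} {mΩ : MeasurableSpace Ω} {P : Measure Ω}
    [SFinite P] {T : ℝ} (hT : 0 ≤ T) {f : ℝ → Ω → ℝ}
    (hf : Integrable (fun p : ℝ × Ω => f p.1 p.2) ((volume.restrict (Icc 0 T)).prod P)) :
    ∫ t in (0 : ℝ)..T, ∫ ω, f t ω ∂P
      = ∫ p : ℝ × Ω, f p.1 p.2 ∂((volume.restrict (Icc 0 T)).prod P) := by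
  rw [intervalIntegral.integral_of_le hT, ← integral_Icc_eq_integral_Ioc, integral_prod _ hf]

lemma IsControl.discountedCost_eq {Ω : Type*} {mΩ : MeasurableSpace Ω} {P : Measure Ω}
    [IsProbabilityMeasure P] {ℱ : Filtration ℝ mΩ} {T m : ℝ} (hT : 0 ≤ T) {u : ℝ → Ω → ℝ}
    (hu : IsControl ℱ T m u) (c : ℝ) :
    discountedCost P c T u = ∫ p : ℝ × Ω, Real.exp (-c * p.1) * u p.1 p.2
      ∂((volume.restrict (Icc 0 T)).prod P) := by
  have h := hu.integrable_mul (P := P) (φ := fun t => Real.exp (-c * t)) (by fun_prop)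
  unfold discountedCost
  simp_rw [intervalIntegral.integral_of_le hT, ← integral_Icc_eq_integral_Ioc]
  rw [integral_prod_symm _ h]

section Goodwill

variable {Ω : Type*} {mΩ : MeasurableSpace Ω} {P : Measure Ω} [IsProbabilityMeasure P]
  {ℱ : Filtration ℝ mΩ} {w : ℝ → Ω → ℝ} {T ρ m x₀ : ℝ} {σ : ℝ → ℝ → ℝ} {u x : ℝ → Ω → ℝ}

lemma IsGoodwill.integrable_drift (hu : IsControl ℱ T m u)
    (hx : IsGoodwill P ℱ T w ρ σ x₀ u x) {t : ℝ} (ht : t ≤ T) :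
    Integrable (fun p : ℝ × Ω => -ρ * x p.1 p.2 + u p.1 p.2)
      ((volume.restrict (Icc 0 t)).prod P) := by
  have h1 : Integrable (fun p : ℝ × Ω => u p.1 p.2) ((volume.restrict (Icc 0 T)).prod P) := by
    simpa using hu.integrable_mul (P := P) (φ := fun _ => 1) continuous_const
  have h2 := ((hx.memLp.integrable one_le_two).const_mul (-ρ)).add h1
  exact h2.mono_measure (Measure.prod_mono (Measure.restrict_mono (Icc_subset_Icc_right ht) le_rfl)
    le_rfl)

lemma IsGoodwill.integrable_and_integral_eq (hw : IsBrownianMotionOn P ℱ T w)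
    (hu : IsControl ℱ T m u) (hx : IsGoodwill P ℱ T w ρ σ x₀ u x) {t : ℝ} (ht : t ∈ Icc 0 T) :
    Integrable (x t) P ∧
      ∫ ω, x t ω ∂P = x₀ + ∫ r in (0 : ℝ)..t, ∫ ω, (-ρ * x r ω + u r ω) ∂P := by
  obtain ⟨I, hI, hEq⟩ := hx.equation
  have hd := hx.integrable_drift hu ht.2
  have hIint : Integrable (I t) P := (hI.memLp t ht).integrable one_le_two
  have hdint : Integrable (fun ω => ∫ r in (0 : ℝ)..t, (-ρ * x r ω + u r ω)) P := by
    simp_rw [intervalIntegral.integral_of_le ht.1, ← integral_Icc_eq_integral_Ioc]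
    exact hd.integral_prod_right
  have hsum : Integrable (fun ω => x₀ + ∫ r in (0 : ℝ)..t, (-ρ * x r ω + u r ω)) P :=
    (integrable_const x₀).add hdint
  refine ⟨(hsum.add hIint).congr (EventuallyEq.symm (hEq t ht)), ?_⟩
  rw [integral_congr_ae (hEq t ht), integral_add hsum hIint,
    integral_add (integrable_const x₀) hdint, hI.integral_eq_zero hw ht,
    intervalIntegral_integral_eq_prod (f := fun r ω => -ρ * x r ω + u r ω) ht.1 hd,
    integral_prod_symm _ hd]
  simp [intervalIntegral.integral_of_le ht.1, ← integral_Icc_eq_integral_Ioc]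

/-- The expected final goodwill as a linear functional of the control. -/
lemma IsGoodwill.exp_mul_integral_eq (hT : 0 ≤ T) (hw : IsBrownianMotionOn P ℱ T w)
    (hu : IsControl ℱ T m u) (hx : IsGoodwill P ℱ T w ρ σ x₀ u x) :
    Real.exp (ρ * T) * ∫ ω, x T ω ∂P = x₀ + ∫ p : ℝ × Ω, Real.exp (ρ * p.1) * u p.1 p.2
      ∂((volume.restrict (Icc 0 T)).prod P) := by
  have huint {r : ℝ} (hr : r ∈ Icc 0 T) : Integrable (u r) P := by
    refine Integrable.of_bound (C := m)
      ((hu.adapted r hr).mono (ℱ.le r) le_rfl).aestronglyMeasurable (Eventually.of_forall fun ω => ?_)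
    rw [Real.norm_of_nonneg (hu.mem_Icc r hr ω).1]
    exact (hu.mem_Icc r hr ω).2
  have hsplit {r : ℝ} (hr : r ∈ Icc 0 T) : ∫ ω, (-ρ * x r ω + u r ω) ∂P
      = -ρ * (∫ ω, x r ω ∂P) + ∫ ω, u r ω ∂P := by
    rw [integral_add ((hx.integrable_and_integral_eq hw hu hr).1.const_mul _) (huint hr),
      integral_const_mul]
  have hdint := (hx.integrable_drift hu le_rfl).integral_prod_left
  have h := exp_mul_eq_of_linear_integral_equation (ρ := ρ) (a := x₀) hT
    (F := fun r => ∫ ω, x r ω ∂P) (v := fun r => ∫ ω, u r ω ∂P) ?_ ?_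
  · rw [h, ← intervalIntegral_integral_eq_prod (f := fun r ω => Real.exp (ρ * r) * u r ω) hT
      (hu.integrable_mul (φ := fun t => Real.exp (ρ * t)) (by fun_prop))]
    simp_rw [integral_const_mul]
  · rw [intervalIntegrable_iff_integrableOn_Icc_of_le hT]
    refine hdint.congr ?_
    filter_upwards [ae_restrict_mem measurableSet_Icc] with r hr using hsplit hr
  · intro t ht
    rw [(hx.integrable_and_integral_eq hw hu ht).2]
    congr 1
    refine intervalIntegral.integral_congr fun r hr => ?_
    rw [uIcc_of_le ht.1] at hr
    exact hsplit ⟨hr.1, hr.2.trans ht.2⟩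

end Goodwill

/-! ### Switching time and cost of the bang-bang policy -/

lemma integral_exp_neg_mul {c : ℝ} (hc : c ≠ 0) (a b : ℝ) :
    ∫ t in a..b, Real.exp (-c * t) = (Real.exp (-c * a) - Real.exp (-c * b)) / c := by
  rw [intervalIntegral.integral_comp_mul_left (fun t => Real.exp t) (neg_ne_zero.2 hc),
    integral_exp]
  simp only [smul_eq_mul]
  field_simp
  ring

lemma switchingTime_eq_iff {c T m M : ℝ} (hc : 0 < c) (hm : 0 < m) (hM : 0 < M) (t : ℝ) :
    Real.exp (-c * t) - Real.exp (-c * T) = c * M / m ↔ t = switchingTime c T m M := by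
  have hpos : 0 < Real.exp (-c * T) + c * M / m := by positivity
  have h1 : t = switchingTime c T m M ↔ -c * t = Real.log (Real.exp (-c * T) + c * M / m) := by
    unfold switchingTime
    constructor
    · rintro rfl; field_simp
    · intro h; rw [← h]; field_simp
  rw [h1, sub_eq_iff_eq_add', ← Real.exp_eq_exp (x := -c * t), Real.exp_log hpos]

/-- The upper bound on `M` gives `0 ≤ τ`; positivity of `M` gives `τ < T`. -/
lemma switchingTime_mem_Ico {c T m M : ℝ} (hc : 0 < c) (hm : 0 < m) (hM : 0 < M)
    (hMm : M ≤ m * ∫ t in (0 : ℝ)..T, Real.exp (-c * t)) :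
    switchingTime c T m M ∈ Ico 0 T := by
  have h := (switchingTime_eq_iff (T := T) hc hm hM _).2 rfl
  have hpos : 0 < c * M / m := by positivity
  rw [integral_exp_neg_mul hc.ne'] at hMm
  have hle : c * M / m ≤ 1 - Real.exp (-c * T) := by
    rw [mul_zero, Real.exp_zero] at hMm
    rw [div_le_iff₀ hm]
    calc c * M ≤ c * (m * ((1 - Real.exp (-c * T)) / c)) := by gcongr
      _ = _ := by field_simp
  constructor
  · have h2 : Real.exp (-c * switchingTime c T m M) ≤ Real.exp 0 := by
      rw [Real.exp_zero]; linarith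
    rw [Real.exp_le_exp] at h2
    nlinarith
  · have h2 : Real.exp (-c * T) < Real.exp (-c * switchingTime c T m M) := by linarith
    rw [Real.exp_lt_exp] at h2
    nlinarith

lemma isControl_bangBang {Ω : Type*} {mΩ : MeasurableSpace Ω} (ℱ : Filtration ℝ mΩ) (T τ : ℝ)
    {m : ℝ} (hm : 0 ≤ m) : IsControl ℱ T m (bangBang (Ω := Ω) m τ) where
  measurable := Measurable.ite (measurableSet_le measurable_fst measurable_const)
    measurable_const measurable_const
  adapted _ _ := measurable_const
  mem_Icc t _ _ := by unfold bangBang; split_ifs <;> simp [hm]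

lemma discountedCost_bangBang {Ω : Type*} {mΩ : MeasurableSpace Ω} (P : Measure Ω)
    [IsProbabilityMeasure P] {c T m τ : ℝ} (hc : c ≠ 0) (hτ : τ ∈ Icc 0 T) :
    discountedCost P c T (bangBang (Ω := Ω) m τ)
      = m * ((Real.exp (-c * τ) - Real.exp (-c * T)) / c) := by
  have h1 : EqOn (fun t => Real.exp (-c * t) * if t ≤ τ then 0 else m) (fun _ => 0) (uIoc 0 τ) := by
    intro t ht
    rw [uIoc_of_le hτ.1] at ht
    simp [ht.2]
  have h2 : EqOn (fun t => Real.exp (-c * t) * if t ≤ τ then 0 else m)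
      (fun t => Real.exp (-c * t) * m) (uIoc τ T) := by
    intro t ht
    rw [uIoc_of_le hτ.2] at ht
    simp [ht.1.not_ge]
  have i1 : IntervalIntegrable (fun t => Real.exp (-c * t) * if t ≤ τ then 0 else m) volume 0 τ :=
    (intervalIntegrable_const (c := (0 : ℝ))).congr h1.symm
  have i2 : IntervalIntegrable (fun t => Real.exp (-c * t) * if t ≤ τ then 0 else m) volume τ T :=
    IntervalIntegrable.congr h2.symm (Continuous.intervalIntegrable (by fun_prop) _ _)
  unfold discountedCost bangBang
  rw [integral_const, probReal_univ, one_smul,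
    ← intervalIntegral.integral_add_adjacent_intervals i1 i2,
    intervalIntegral.integral_congr_ae (Eventually.of_forall fun _ h => h1 h),
    intervalIntegral.integral_congr_ae (Eventually.of_forall fun _ h => h2 h),
    intervalIntegral.integral_mul_const, integral_exp_neg_mul hc, intervalIntegral.integral_zero,
    zero_add, mul_comm]

/-! ### Comparison with the bang-bang policy -/

/-- The integrand that compares a control with a bang-bang policy. -/
noncomputable def bangBangGap {Ω : Type*} (ρ c m τ : ℝ) (u : ℝ → Ω → ℝ) (p : ℝ × Ω) : ℝ :=
  (Real.exp (ρ * p.1) - Real.exp ((ρ + c) * τ) * Real.exp (-c * p.1)) *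
    (bangBang m τ p.1 p.2 - u p.1 p.2)

/-- In the factored form, for `ρ + c > 0`, the sign is visibly that of `t - τ`. -/
lemma exp_sub_mul_exp_neg (ρ c τ t : ℝ) :
    Real.exp (ρ * t) - Real.exp ((ρ + c) * τ) * Real.exp (-c * t)
      = (Real.exp ((ρ + c) * t) - Real.exp ((ρ + c) * τ)) * Real.exp (-c * t) := by
  rw [sub_mul, ← Real.exp_add ((ρ + c) * t)]
  ring_nf

section BangBang

variable {Ω : Type*} {mΩ : MeasurableSpace Ω} {P : Measure Ω} [IsProbabilityMeasure P]
  {ℱ : Filtration ℝ mΩ} {T ρ c m τ : ℝ} {u : ℝ → Ω → ℝ}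

lemma IsControl.bangBangGap_nonneg (hu : IsControl ℱ T m u) (hρc : 0 < ρ + c) :
    0 ≤ᵐ[(volume.restrict (Icc 0 T)).prod P] bangBangGap ρ c m τ u := by
  filter_upwards [ae_fst_mem_Icc P T] with p hp
  have hup := hu.mem_Icc p.1 hp p.2
  simp only [Pi.zero_apply, bangBangGap, bangBang, exp_sub_mul_exp_neg]
  split_ifs with h
  · refine mul_nonneg_of_nonpos_of_nonpos (mul_nonpos_of_nonpos_of_nonneg ?_ (Real.exp_nonneg _))
      (by linarith [hup.1])
    rw [sub_nonpos]
    gcongr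
  · refine mul_nonneg (mul_nonneg ?_ (Real.exp_nonneg _)) (by linarith [hup.2])
    rw [sub_nonneg]
    push Not at h
    gcongr

lemma IsControl.integral_bangBangGap (hT : 0 ≤ T) (hm : 0 ≤ m) (hu : IsControl ℱ T m u) :
    Integrable (bangBangGap ρ c m τ u) ((volume.restrict (Icc 0 T)).prod P) ∧
    ∫ p, bangBangGap ρ c m τ u p ∂((volume.restrict (Icc 0 T)).prod P)
      = ((∫ p : ℝ × Ω, Real.exp (ρ * p.1) * bangBang m τ p.1 p.2
          ∂((volume.restrict (Icc 0 T)).prod P))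
        - ∫ p : ℝ × Ω, Real.exp (ρ * p.1) * u p.1 p.2 ∂((volume.restrict (Icc 0 T)).prod P))
      - Real.exp ((ρ + c) * τ) * (discountedCost P c T (bangBang (Ω := Ω) m τ)
        - discountedCost P c T u) := by
  have hb := isControl_bangBang ℱ T τ hm
  have iρ {v : ℝ → Ω → ℝ} (hv : IsControl ℱ T m v) := hv.integrable_mul (P := P)
    (φ := fun t => Real.exp (ρ * t)) (by fun_prop)
  have ic {v : ℝ → Ω → ℝ} (hv : IsControl ℱ T m v) := hv.integrable_mul (P := P)
    (φ := fun t => Real.exp (-c * t)) (by fun_prop)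
  have hrw : bangBangGap ρ c m τ u = fun p : ℝ × Ω =>
      (Real.exp (ρ * p.1) * bangBang m τ p.1 p.2 - Real.exp (ρ * p.1) * u p.1 p.2)
      - Real.exp ((ρ + c) * τ) * (Real.exp (-c * p.1) * bangBang m τ p.1 p.2
        - Real.exp (-c * p.1) * u p.1 p.2) := by
    ext p
    unfold bangBangGap
    ring
  have i1 := (iρ hb).sub (iρ hu)
  have i2 := ((ic hb).sub (ic hu)).const_mul (Real.exp ((ρ + c) * τ))
  rw [hrw]
  refine ⟨i1.sub i2, ?_⟩
  refine (integral_sub i1 i2).trans ?_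
  rw [integral_const_mul]
  simp only [Pi.sub_apply]
  rw [integral_sub (iρ hb) (iρ hu), integral_sub (ic hb) (ic hu), hb.discountedCost_eq hT,
    hu.discountedCost_eq hT]

end BangBang

/-- The exponential factor of the gap vanishes only on the null slice `t = τ`. -/
lemma ae_eq_bangBang_of_gap_eq_zero {Ω : Type*} {mΩ : MeasurableSpace Ω} {P : Measure Ω}
    [SFinite P] {T ρ c m τ : ℝ} {u : ℝ → Ω → ℝ} (hρc : 0 < ρ + c)
    (h : bangBangGap ρ c m τ u =ᵐ[(volume.restrict (Icc 0 T)).prod P] 0) :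
    (fun p : ℝ × Ω => u p.1 p.2) =ᵐ[(volume.restrict (Icc 0 T)).prod P]
      fun p => bangBang m τ p.1 p.2 := by
  have hne : ∀ᵐ p : ℝ × Ω ∂((volume.restrict (Icc 0 T)).prod P), p.1 ≠ τ :=
    Measure.quasiMeasurePreserving_fst.ae (Measure.ae_ne _ τ)
  filter_upwards [h, hne] with p hp hpτ
  simp only [bangBangGap, exp_sub_mul_exp_neg, Pi.zero_apply, mul_eq_zero, sub_eq_zero,
    Real.exp_ne_zero, or_false, Real.exp_eq_exp] at hp
  rcases hp with hp | hp
  · exact absurd (mul_left_cancel₀ hρc.ne' hp) hpτ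
  · exact hp.symm

theorem mainTheorem3 {Ω : Type*} {mΩ : MeasurableSpace Ω} (P : Measure Ω)
    [IsProbabilityMeasure P] (ℱ : Filtration ℝ mΩ) (w : ℝ → Ω → ℝ)
    (T ρ c m M x₀ : ℝ) (σ : ℝ → ℝ → ℝ)
    (hT : 0 < T) (hρ : 0 < ρ) (hc : 0 < c) (hm : 0 < m) (hM : 0 < M)
    (hMm : M ≤ m * ∫ t in (0 : ℝ)..T, Real.exp (-c * t))
    (hσ : Measurable (fun p : ℝ × ℝ => σ p.1 p.2))
    (hw : IsBrownianMotionOn P ℱ T w) :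
    -- the switching time lies in `[0, T)` and is the only solution of its equation
    switchingTime c T m M ∈ Ico 0 T ∧
    (∀ t : ℝ, Real.exp (-c * t) - Real.exp (-c * T) = c * M / m ↔ t = switchingTime c T m M) ∧
    -- the bang-bang policy is feasible and uses the whole budget
    IsFeasible P ℱ T m c M (bangBang m (switchingTime c T m M)) ∧
    discountedCost P c T (bangBang (Ω := Ω) m (switchingTime c T m M)) = M ∧
    -- the expected final goodwill is well defined for every admissible control
    (∀ u x : ℝ → Ω → ℝ, IsControl ℱ T m u → IsGoodwill P ℱ T w ρ σ x₀ u x →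
      Integrable (x T) P) ∧
    -- the bang-bang policy is optimal, and every optimal control agrees with it a.e.
    (∀ y : ℝ → Ω → ℝ,
      IsGoodwill P ℱ T w ρ σ x₀ (bangBang m (switchingTime c T m M)) y →
      IsGreatest (constrainedValues P ℱ T w ρ σ x₀ m c M) (∫ ω, y T ω ∂P) ∧
      ∀ u x : ℝ → Ω → ℝ, IsFeasible P ℱ T m c M u → IsGoodwill P ℱ T w ρ σ x₀ u x →
        ∫ ω, x T ω ∂P = ∫ ω, y T ω ∂P →
        (fun p : ℝ × Ω => u p.1 p.2) =ᵐ[(volume.restrict (Icc 0 T)).prod P]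
          fun p => bangBang m (switchingTime c T m M) p.1 p.2) := by
  have hτ := switchingTime_mem_Ico hc hm hM hMm
  have hτeq := switchingTime_eq_iff (T := T) hc hm hM
  set τ := switchingTime c T m M with hτdef
  have hρc : 0 < ρ + c := by positivity
  have hb := isControl_bangBang ℱ T τ hm.le
  have hcost : discountedCost P c T (bangBang (Ω := Ω) m τ) = M := by
    rw [discountedCost_bangBang P hc.ne' (Ico_subset_Icc_self hτ), (hτeq τ).2 rfl]
    field_simp
  refine ⟨hτ, hτeq, ⟨hb, hcost.le⟩, hcost, fun u x hu hx =>
    (hx.integrable_and_integral_eq hw hu ⟨hT.le, le_rfl⟩).1, fun y hy => ?_⟩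
  have hbound {u x : ℝ → Ω → ℝ} (hu : IsFeasible P ℱ T m c M u)
      (hx : IsGoodwill P ℱ T w ρ σ x₀ u x) :
      ∫ p, bangBangGap ρ c m τ u p ∂((volume.restrict (Icc 0 T)).prod P)
        ≤ Real.exp (ρ * T) * (∫ ω, y T ω ∂P - ∫ ω, x T ω ∂P) := by
    have h1 := (hu.1.integral_bangBangGap (P := P) (ρ := ρ) (c := c) (τ := τ) hT.le hm.le).2
    have h2 := hx.exp_mul_integral_eq hT.le hw hu.1
    have h3 := hy.exp_mul_integral_eq hT.le hw hb
    -- The multiplier is nonnegative, so unspent budget only helps the inequality.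
    have h4 : 0 ≤ Real.exp ((ρ + c) * τ) * (M - discountedCost P c T u) :=
      mul_nonneg (Real.exp_nonneg _) (sub_nonneg.2 hu.2)
    rw [hcost] at h1
    rw [mul_sub]
    linarith
  refine ⟨⟨⟨_, y, ⟨hb, hcost.le⟩, hy, rfl⟩, ?_⟩, fun u x hu hx hxy => ?_⟩
  · rintro J ⟨u, x, hu, hx, rfl⟩
    have h := (integral_nonneg_of_ae (hu.1.bangBangGap_nonneg hρc)).trans (hbound hu hx)
    exact sub_nonneg.1 (nonneg_of_mul_nonneg_right h (Real.exp_pos _))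
  · have hle := hbound hu hx
    rw [hxy, sub_self, mul_zero] at hle
    have hnn := hu.1.bangBangGap_nonneg (P := P) (τ := τ) hρc
    exact ae_eq_bangBang_of_gap_eq_zero hρc ((integral_eq_zero_iff_of_nonneg_ae hnn
      (hu.1.integral_bangBangGap hT.le hm.le).1).1 (hle.antisymm (integral_nonneg_of_ae hnn)))
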